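/- Let $k$ be a field, let $0 \le a \le n$ and $m \ge 0$, and let $X = (x_{i,j})$ be the generic $m \times n$ matrix whose entries are the variables of the polynomial ring $R = k[x_{i,j} : 1 \le i \le m,\ 1 \le j \le n]$. Write $X = (A\,B)$ as a block matrix, where $A$ consists of the first $a$ columns and $B$ of the remaining $n-a$ columns. Let $p < q$ be integers and grade $R$ by $\deg x_{i,j} = p$ if $j \le a$ and $\deg x_{i,j} = q$ if $j > a$; every minor of $X$ is then homogeneous. For a matrix $M$ over $R$ and an integer $s$, let $I_s(M)$ be the ideal of $R$ generated by the $s$-minors of $M$, with $I_s(M) = R$ for $s \le 0$ (and $I_s(M) = 0$ if $M$ has no $s$-minors, $s > 0$). Fix an integer $t \ge 0$ and an integer $d$, let $I_t(X)_{\le d}$ be the ideal generated by those $t$-minors of $X$ whose degree is at most $d$, and put $$r = \left\lceil \frac{tq-d}{q-p} \right\rceil .$$ Assume that $r \le t$ (equivalently, $d \ge tp$) or that $r > \min(m,a)$. Then $$I_t(X)_{\le d} = I_t(X) \cap I_r(A).$$ -/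

import Mathlib

/-- The set of `t`-minors of an `m × n` matrix: determinants of the `t × t` submatrices on
`t` rows and `t` columns, each listed in increasing order.
The only `0`-minor is `1`; if `t > m` or `t > n` there are no `t`-minors. -/
def minorSet {S : Type*} [CommRing S] {m n : ℕ} (M : Matrix (Fin m) (Fin n) S) (t : ℕ) : Set S :=
  {f | ∃ (rows : Fin t ↪o Fin m) (cols : Fin t ↪o Fin n), f = (M.submatrix rows cols).det}

/-- The determinantal ideal `I_r(M)` generated by the `r`-minors of `M`, for an integer `r`.
For `r ≤ 0` this is the unit ideal, as `0`-minors equal `1`. -/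
def minorIdeal {S : Type*} [CommRing S] {m n : ℕ} (M : Matrix (Fin m) (Fin n) S) (r : ℤ) :
    Ideal S :=
  Ideal.span (minorSet M r.toNat)

/-- The block `A` of `X = (A B)`: the first `a` columns. -/
def leftBlock {S : Type*} {m n a : ℕ} (ha : a ≤ n) (M : Matrix (Fin m) (Fin n) S) :
    Matrix (Fin m) (Fin a) S :=
  M.submatrix id (Fin.castLE ha)

/-- The degrees of the variables `x_{i,j}`: `p` in the first `a` columns and `q` in the others. -/
def blockDegree (m n a : ℕ) (p q : ℤ) : Fin m × Fin n → ℤ :=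
  fun x => if (x.2 : ℕ) < a then p else q

/-- `I_t(X)_{≤ d}`: the ideal generated by those `t`-minors of the generic `m × n` matrix `X`
which are homogeneous of some degree `≤ d` for the grading given by `blockDegree`.
(The minors of a generic matrix over a nontrivial ring are nonzero, so the degree is unique.) -/
noncomputable def lowDegreeMinorIdeal (k : Type*) [CommRing k] (m n a : ℕ) (p q : ℤ) (t : ℕ) (d : ℤ) :
    Ideal (MvPolynomial (Fin m × Fin n) k) :=
  Ideal.span {f | f ∈ minorSet (Matrix.mvPolynomialX (Fin m) (Fin n) k) t ∧
    ∃ e : ℤ, MvPolynomial.IsWeightedHomogeneous (blockDegree m n a p q) f e ∧ e ≤ d}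

/-! A `t`-minor with `b` columns in `A` has degree `t q - b (q - p)`, so it has degree at most `d`
exactly when `b ≥ r`. Laplace expansion then gives the inclusion of the left side in the right. If
`r > min(m, a)`, the right side is zero.

The substantial case is `r ≤ t`, treated by standard monomial theory. Up to sign, the minors of `X`
are maximal minors of `(X 1)`, indexed by `m`-sets `S` of columns; `S.count n` and `S.count a` bound
from below the size of the minor and its number of columns in `A`. Straightening
(`minorProd_mem_span_standard`) never raises the first factor, so an element of `I_t(X)` is a
combination of standard products whose first factors satisfy `S.count n ≥ t`. An element of `I_r(A)`
vanishes on the generic echelon matrices of all `D` with `D.count a < r`, since a minor on `S`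
vanishes there unless `D ≤ S`. By independence of standard products
(`head_mem_of_linearCombination_eq_zero`), the first factors also satisfy `S.count a ≥ r`. Such a
factor expands into `t`-minors with at least `r` columns in `A` (`maxMinor_augment_mem`). -/

theorem Matrix.det_eq_zero_of_zero_block {ι S : Type*} [CommRing S] [Fintype ι] [DecidableEq ι]
    (M : Matrix ι ι S) (R C : Finset ι) (hcard : R.card < C.card)
    (h : ∀ i ∉ R, ∀ j ∈ C, M i j = 0) : M.det = 0 := by
  rw [Matrix.det_apply]
  refine Finset.sum_eq_zero fun σ _ => ?_
  -- Pigeonhole: `σ` cannot inject `C` into the smaller set `R`.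
  obtain ⟨j, hj, hσ⟩ : ∃ j ∈ C, σ j ∉ R := by
    by_contra! hc
    exact absurd (Finset.card_le_card_of_injOn σ hc σ.injective.injOn) (by omega)
  have h0 : ∏ i, M (σ i) i = 0 := Finset.prod_eq_zero (Finset.mem_univ j) (h _ hσ j hj)
  simp [h0]

/-- The sets of `m` columns of an `m × N` matrix. -/
def ColSet (m N : ℕ) : Type := {S : Finset (Fin N) // S.card = m}

/-! ### The poset of column sets -/

namespace ColSet

variable {m N : ℕ}

/-- The number of columns in `S` among the first `c` ones. -/
def count (S : ColSet m N) (c : ℕ) : ℕ := (S.1.filter fun j : Fin N => (j : ℕ) < c).card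

theorem count_succ (S : ColSet m N) (j : Fin N) :
    S.count (j + 1) = S.count j + if j ∈ S.1 then 1 else 0 := by
  have h : (S.1.filter fun x : Fin N => (x : ℕ) < j + 1) =
      (S.1.filter fun x : Fin N => (x : ℕ) < j) ∪ (S.1.filter fun x => x = j) := by
    ext x
    simp only [Finset.mem_filter, Finset.mem_union, Fin.ext_iff]
    grind
  rw [count, h, Finset.card_union_of_disjoint]
  · rw [Finset.filter_eq']
    split_ifs <;> simp [count]
  · rw [Finset.disjoint_filter]
    rintro x - hx rfl
    exact lt_irrefl _ hx

/-- `S ≤ T` if the `i`-th column of `S` is at most the `i`-th column of `T`, for all `i`. -/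
instance : PartialOrder (ColSet m N) where
  le S T := ∀ c, T.count c ≤ S.count c
  le_refl S c := le_rfl
  le_trans S T U h h' c := (h' c).trans (h c)
  le_antisymm S T h h' := by
    have hc : ∀ c, S.count c = T.count c := fun c => le_antisymm (h' c) (h c)
    refine Subtype.ext (Finset.ext fun j => ?_)
    have h1 := S.count_succ j
    have h2 := T.count_succ j
    rw [hc, hc] at h1
    split_ifs at h1 h2 with hS hT hT <;> simp_all

theorem le_def {S T : ColSet m N} : S ≤ T ↔ ∀ c, T.count c ≤ S.count c := Iff.rfl

instance : Finite (ColSet m N) := inferInstanceAs (Finite {S : Finset (Fin N) // S.card = m})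

/-- The columns in `S`, in increasing order. -/
def emb (S : ColSet m N) : Fin m ↪o Fin N := S.1.orderEmbOfFin S.2

theorem image_emb (S : ColSet m N) : Finset.univ.image S.emb = S.1 :=
  Finset.image_orderEmbOfFin_univ _ _

theorem emb_mem (S : ColSet m N) (i : Fin m) : S.emb i ∈ S.1 :=
  Finset.orderEmbOfFin_mem _ _ _

theorem exists_emb_eq {S : ColSet m N} {j : Fin N} (hj : j ∈ S.1) : ∃ i, S.emb i = j := by
  rw [← S.image_emb] at hj
  simpa using hj

theorem card_emb_lt (S : ColSet m N) (c : ℕ) :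
    (Finset.univ.filter fun i => (S.emb i : ℕ) < c).card = S.count c := by
  rw [count, ← Finset.card_image_of_injective _ S.emb.injective]
  congr 1
  ext j
  simp only [Finset.mem_image, Finset.mem_filter, Finset.mem_univ, true_and]
  constructor
  · rintro ⟨i, hi, rfl⟩
    exact ⟨S.emb_mem i, hi⟩
  · rintro ⟨hj, hc⟩
    obtain ⟨i, rfl⟩ := exists_emb_eq hj
    exact ⟨i, hc, rfl⟩

theorem count_emb (S : ColSet m N) (i : Fin m) : S.count (S.emb i) = i := by
  rw [← S.card_emb_lt]
  simp only [Fin.val_fin_lt, S.emb.lt_iff_lt]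
  rw [Finset.filter_gt_eq_Iio, Fin.card_Iio]

theorem lt_count_iff (S : ColSet m N) (i : Fin m) (c : ℕ) :
    (i : ℕ) < S.count c ↔ (S.emb i : ℕ) < c := by
  rw [← S.card_emb_lt]
  constructor
  · intro h
    by_contra hc
    have : (Finset.univ.filter fun x => (S.emb x : ℕ) < c) ⊆ Finset.Iio i := by
      intro x hx
      simp only [Finset.mem_filter, Finset.mem_univ, true_and, Finset.mem_Iio] at hx ⊢
      by_contra hxi
      have := S.emb.monotone (not_lt.1 hxi)
      rw [Fin.le_def] at this
      omega
    have := Finset.card_le_card this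
    simp at this
    omega
  · intro h
    have : Finset.Iic i ⊆ (Finset.univ.filter fun x => (S.emb x : ℕ) < c) := by
      intro x hx
      simp only [Finset.mem_filter, Finset.mem_univ, true_and, Finset.mem_Iic] at hx ⊢
      have := S.emb.monotone hx
      rw [Fin.le_def] at this
      omega
    have := Finset.card_le_card this
    simp at this
    omega

theorem count_le (S : ColSet m N) (c : ℕ) : S.count c ≤ m :=
  (Finset.card_filter_le _ _).trans S.2.le

theorem count_add_card (S : ColSet m N) (c : ℕ) :
    S.count c + (S.1.filter fun j : Fin N => ¬ (j : ℕ) < c).card = m := by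
  rw [count, Finset.card_filter_add_card_filter_not, S.2]

end ColSet

/-! ### Exchange relations and the straightening law -/

section maxMinor

variable {m N : ℕ} {A : Type*} [CommRing A]

/-- The maximal minor of `Y` on the columns in `S`. -/
def maxMinor (Y : Matrix (Fin m) (Fin N) A) (S : ColSet m N) : A := (Y.submatrix id S.emb).det

theorem map_maxMinor {B : Type*} [CommRing B] (f : A →+* B) (Y : Matrix (Fin m) (Fin N) A)
    (S : ColSet m N) : f (maxMinor Y S) = maxMinor (Y.map f) S := by
  rw [maxMinor, RingHom.map_det]
  rfl

theorem maxMinor_mul (P : Matrix (Fin m) (Fin m) A) (Y : Matrix (Fin m) (Fin N) A)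
    (S : ColSet m N) : maxMinor (P * Y) S = P.det * maxMinor Y S := by
  rw [maxMinor, maxMinor, ← Matrix.det_mul]
  rfl

theorem det_submatrix_eq_maxMinor (Y : Matrix (Fin m) (Fin N) A) {g : Fin m → Fin N}
    (hg : Function.Injective g) : ∃ ε : ℤˣ, (Y.submatrix id g).det =
      ε • maxMinor Y ⟨Finset.univ.image g, by simp [Finset.card_image_of_injective _ hg]⟩ := by
  set S : ColSet m N := ⟨Finset.univ.image g, by simp [Finset.card_image_of_injective _ hg]⟩
  have hS : ∀ i, ∃ j, S.emb j = g i := fun i => ColSet.exists_emb_eq (by simp [S])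
  choose s hs using hS
  have hinj : Function.Injective s := fun i j hij => hg (by rw [← hs, ← hs, hij])
  let σ : Equiv.Perm (Fin m) := Equiv.ofBijective s (Finite.injective_iff_bijective.1 hinj)
  refine ⟨Equiv.Perm.sign σ, ?_⟩
  have : Y.submatrix id g = (Y.submatrix id S.emb).submatrix id σ := by
    ext i j
    simp [σ, hs]
  rw [this, Matrix.det_permute', maxMinor, Units.smul_def, zsmul_eq_mul]

/-- An entry of `Y`, put into the upper or the lower half of a column of height `2 m`. -/
def halfEntry (Y : Matrix (Fin m) (Fin N) A) (i : Fin m ⊕ Fin m) (x : Fin N) (b : Bool) : A :=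
  Sum.elim (fun i => if b then Y i x else 0) (fun i => if b then 0 else Y i x) i

/-- Unless each half receives exactly `m` columns, a zero block kills the determinant; otherwise a
column permutation makes it block diagonal. The data on `S` and on `h` serve to compare `S` with the
original column set in the exchange relation. -/
theorem det_halfEntry (Y : Matrix (Fin m) (Fin N) A) (g : Fin m ⊕ Fin m → Fin N)
    (h : Fin m ⊕ Fin m → Bool) :
    (Matrix.of fun i j => halfEntry Y i (g j) (h j)).det = 0 ∨
    ∃ (S T : ColSet m N) (ε : ℤˣ),
      (Matrix.of fun i j => halfEntry Y i (g j) (h j)).det = ε • (maxMinor Y S * maxMinor Y T) ∧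
      S.1 = (Finset.univ.filter fun j => h j = true).image g ∧
      Set.InjOn g {j | h j = true} ∧ (Finset.univ.filter fun j => h j = true).card = m := by
  set M : Matrix (Fin m ⊕ Fin m) (Fin m ⊕ Fin m) A :=
    Matrix.of fun i j => halfEntry Y i (g j) (h j) with hM
  have htot : (Finset.univ.filter fun j => h j = true).card +
      (Finset.univ.filter fun j => ¬ h j = true).card = m + m := by
    rw [Finset.card_filter_add_card_filter_not]; simp
  rcases lt_trichotomy (Finset.univ.filter fun j => h j = true).card m with hlt | heq | hgt
  · left
    refine M.det_eq_zero_of_zero_block (Finset.univ.map Function.Embedding.inr)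
      (Finset.univ.filter fun j => ¬ h j = true) ?_ ?_
    · simp only [Finset.card_map, Finset.card_univ, Fintype.card_fin]; omega
    · rintro (i | i) hi j hj
      · simp only [Finset.mem_filter, Finset.mem_univ, true_and] at hj
        simp [hM, halfEntry, hj]
      · simp at hi
  · obtain ⟨e₁⟩ : Nonempty (Fin m ≃ {j // h j = true}) := by
      refine ⟨Fintype.equivOfCardEq ?_⟩
      rw [Fintype.card_subtype, heq, Fintype.card_fin]
    obtain ⟨e₂⟩ : Nonempty (Fin m ≃ {j // ¬ h j = true}) := by
      refine ⟨Fintype.equivOfCardEq ?_⟩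
      rw [Fintype.card_subtype, Fintype.card_fin]
      omega
    let σ : Equiv.Perm (Fin m ⊕ Fin m) := (Equiv.sumCongr e₁ e₂).trans (Equiv.sumCompl _)
    have hblock : M.submatrix id σ = Matrix.fromBlocks (Y.submatrix id fun i => g (e₁ i)) 0 0
        (Y.submatrix id fun i => g (e₂ i)) := by
      ext (i | i) (j | j)
      · simp [hM, σ, halfEntry, (e₁ j).2]
      · simp [hM, σ, halfEntry, (e₂ j).2]
      · simp [hM, σ, halfEntry, (e₁ j).2]
      · simp [hM, σ, halfEntry, (e₂ j).2]
    have hdet := M.det_permute' σ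
    rw [hblock, Matrix.det_fromBlocks_zero₂₁] at hdet
    have hdet' : M.det = Equiv.Perm.sign σ • ((Y.submatrix id fun i => g (e₁ i)).det *
        (Y.submatrix id fun i => g (e₂ i)).det) := by
      rw [hdet, Units.smul_def, zsmul_eq_mul, ← mul_assoc, ← Int.cast_mul, Int.units_coe_mul_self]
      simp
    have hzero : ∀ f : Fin m → Fin N, ¬ Function.Injective f → (Y.submatrix id f).det = 0 := by
      intro f hf
      simp only [Function.Injective, not_forall] at hf
      obtain ⟨i, j, hij, hne⟩ := hf
      exact Matrix.det_zero_of_column_eq hne fun k => by simp [hij]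
    by_cases h₁ : Function.Injective fun i => g (e₁ i)
    swap
    · left; rw [hdet', hzero _ h₁]; simp
    by_cases h₂ : Function.Injective fun i => g (e₂ i)
    swap
    · left; rw [hdet', hzero _ h₂]; simp
    right
    obtain ⟨ε₁, hε₁⟩ := det_submatrix_eq_maxMinor Y h₁
    obtain ⟨ε₂, hε₂⟩ := det_submatrix_eq_maxMinor Y h₂
    refine ⟨⟨Finset.univ.image fun i => g (e₁ i), by simp [Finset.card_image_of_injective _ h₁]⟩,
      ⟨Finset.univ.image fun i => g (e₂ i), by simp [Finset.card_image_of_injective _ h₂]⟩, Equiv.Perm.sign σ * (ε₁ * ε₂), ?_, ?_, ?_, heq⟩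
    · rw [hdet', hε₁, hε₂, smul_mul_smul_comm, smul_smul]
    · ext x
      simp only [Finset.mem_image, Finset.mem_univ, true_and, Finset.mem_filter]
      constructor
      · rintro ⟨i, rfl⟩
        exact ⟨_, (e₁ i).2, rfl⟩
      · rintro ⟨j, hj, rfl⟩
        exact ⟨e₁.symm ⟨j, hj⟩, by simp⟩
    · intro i hi j hj hij
      have := @h₁ (e₁.symm ⟨i, hi⟩) (e₁.symm ⟨j, hj⟩) (by simpa using hij)
      simpa using this
  · left
    refine M.det_eq_zero_of_zero_block (Finset.univ.map Function.Embedding.inl)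
      (Finset.univ.filter fun j => h j = true) ?_ ?_
    · simp only [Finset.card_map, Finset.card_univ, Fintype.card_fin]; omega
    · rintro (i | i) hi j hj
      · simp at hi
      · simp only [Finset.mem_filter, Finset.mem_univ, true_and] at hj
        simp [hM, halfEntry, hj]

/-- A Plücker relation. Where `T` has more columns than `S` before `c`, the columns of `S` from `c`
on and those of `T` before `c` number more than `m`. Placing each of them in both halves gives a
singular matrix of size `2 m`; its multilinear expansion contains the given product, and every other
nonzero term exchanges columns of `S` for earlier ones of `T`. -/
theorem maxMinor_mul_maxMinor_mem_span (k : Type*) [CommRing k] [Algebra k A]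
    (Y : Matrix (Fin m) (Fin N) A) {S T : ColSet m N} (hST : ¬ S ≤ T) :
    maxMinor Y S * maxMinor Y T ∈
      Submodule.span k {x | ∃ S' T', S' < S ∧ x = maxMinor Y S' * maxMinor Y T'} := by
  obtain ⟨c, hc⟩ : ∃ c, S.count c < T.count c := by
    simpa [ColSet.le_def] using hST
  let g : Fin m ⊕ Fin m → Fin N := Sum.elim S.emb T.emb
  -- Columns of `S` before `c` stay in the upper half, those of `T` from `c` on in the lower half;
  -- the others are free.
  let allowed : Fin m ⊕ Fin m → Bool → Prop := fun j b =>
    Sum.elim (fun i => (S.emb i : ℕ) < c → b = true) (fun i => b = true → (T.emb i : ℕ) < c) j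
  have hdec : ∀ j b, Decidable (allowed j b) := fun j b => Classical.dec _
  let v : Fin m ⊕ Fin m → Bool → Fin m ⊕ Fin m → A := fun j b i =>
    if allowed j b then halfEntry Y i (g j) b else 0
  let G : Matrix (Fin m ⊕ Fin m) (Fin m ⊕ Fin m) A := Matrix.of fun i j => ∑ b, v j b i
  have hG0 : G.det = 0 := by
    -- Subtracting the upper rows from the lower ones leaves the free columns supported on only `m`
    -- rows.
    let E : Matrix (Fin m ⊕ Fin m) (Fin m ⊕ Fin m) A := Matrix.fromBlocks 1 0 (-1) 1
    have hE : E.det = 1 := by simp [E]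
    have hEG : (E * G).det = 0 := by
      refine Matrix.det_eq_zero_of_zero_block _ (Finset.univ.map Function.Embedding.inl)
        ((Finset.univ.filter fun i => ¬ (S.emb i : ℕ) < c).disjSum
          (Finset.univ.filter fun i => (T.emb i : ℕ) < c)) ?_ ?_
      · have h1 : (Finset.univ.filter fun i => (S.emb i : ℕ) < c).card +
            (Finset.univ.filter fun i => ¬ (S.emb i : ℕ) < c).card = m := by
          rw [Finset.card_filter_add_card_filter_not]; simp
        rw [S.card_emb_lt] at h1
        rw [Finset.card_disjSum, T.card_emb_lt]
        simp only [Finset.card_map, Finset.card_univ, Fintype.card_fin]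
        omega
      · rintro (i | i) hi j hj
        · simp at hi
        · have hrow : (E * G) (Sum.inr i) j = G (Sum.inr i) j - G (Sum.inl i) j := by
            simp [E, Matrix.mul_apply, Matrix.one_apply]
            ring
          rw [hrow]
          rcases j with j | j
          · have hj' : ¬ (S.emb j : ℕ) < c := by simpa using hj
            simp [G, v, halfEntry, allowed, g, not_lt.1 hj']
          · have hj' : (T.emb j : ℕ) < c := by simpa using hj
            simp [G, v, halfEntry, allowed, g, hj']
    rwa [Matrix.det_mul, hE, one_mul] at hEG
  have hsum : G.det = ∑ h : Fin m ⊕ Fin m → Bool, (Matrix.of fun i j => v j (h j) i).det := by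
    rw [← Matrix.det_transpose]
    have := (Matrix.detRowAlternating (n := Fin m ⊕ Fin m) (R := A)).toMultilinearMap.map_sum v
    simp only [AlternatingMap.coe_multilinearMap] at this
    have h1 : G.transpose.det = Matrix.detRowAlternating fun i => ∑ j, v i j := by
      rw [Matrix.detRowAlternating]
      congr 1
    rw [h1, this]
    refine Finset.sum_congr rfl fun h _ => ?_
    rw [← Matrix.det_transpose]
    rfl
  let h₀ : Fin m ⊕ Fin m → Bool := Sum.isLeft
  have hmain : (Matrix.of fun i j => v j (h₀ j) i).det = maxMinor Y S * maxMinor Y T := by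
    rw [maxMinor, maxMinor, ← Matrix.det_fromBlocks_zero₂₁ _ 0]
    congr 1
    ext (i | i) (j | j) <;> simp [v, h₀, allowed, halfEntry, g]
  rw [hsum, ← Finset.add_sum_erase _ _ (Finset.mem_univ h₀), hmain] at hG0
  rw [eq_neg_of_add_eq_zero_left hG0]
  refine Submodule.neg_mem _ (Submodule.sum_mem _ fun h hh => ?_)
  have hne : h ≠ h₀ := Finset.ne_of_mem_erase hh
  by_cases hall : ∀ j, allowed j (h j)
  swap
  · push Not at hall
    obtain ⟨j, hj⟩ := hall
    rw [Matrix.det_eq_zero_of_column_eq_zero j fun i => by simp [v, hj]]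
    exact Submodule.zero_mem _
  have hv : (Matrix.of fun i j => v j (h j) i) =
      Matrix.of fun i j => halfEntry Y i (g j) (h j) := by
    ext i j
    simp [v, hall]
  rw [hv]
  rcases det_halfEntry Y g h with h0 | ⟨S', T', ε, hε, hS', hinj, hcard⟩
  · rw [h0]; exact Submodule.zero_mem _
  rw [hε, Units.smul_def]
  refine zsmul_mem (Submodule.subset_span ?_) _
  refine ⟨S', T', ?_, rfl⟩
  have hmemS' : ∀ x, x ∈ S'.1 ↔ (∃ i, h (Sum.inl i) = true ∧ S.emb i = x) ∨
      (∃ i, h (Sum.inr i) = true ∧ T.emb i = x) := by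
    intro x
    simp [hS', g]
  have hl : ∀ i, (S.emb i : ℕ) < c → h (Sum.inl i) = true := fun i => hall (Sum.inl i)
  have hr : ∀ i, h (Sum.inr i) = true → (T.emb i : ℕ) < c := fun i => hall (Sum.inr i)
  refine lt_of_le_of_ne ?_ ?_
  · intro c'
    rcases le_total c' c with hcc | hcc
    · refine Finset.card_le_card fun x hx => ?_
      rw [Finset.mem_filter] at hx ⊢
      obtain ⟨i, rfl⟩ := ColSet.exists_emb_eq hx.1
      exact ⟨(hmemS' _).2 (Or.inl ⟨i, hl i (by omega), rfl⟩), hx.2⟩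
    · have h1 := S.count_add_card c'
      have h2 := S'.count_add_card c'
      have h3 : (S'.1.filter fun j : Fin N => ¬ (j : ℕ) < c').card ≤
          (S.1.filter fun j : Fin N => ¬ (j : ℕ) < c').card := by
        refine Finset.card_le_card fun x hx => ?_
        rw [Finset.mem_filter] at hx ⊢
        refine ⟨?_, hx.2⟩
        rcases (hmemS' x).1 hx.1 with ⟨i, -, rfl⟩ | ⟨i, hi, rfl⟩
        · exact S.emb_mem i
        · exact absurd (hr i hi) (by omega)
      omega
  -- If `S' = S`, a column of `T` moved up would repeat a column of `S` already in the upper half;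
  -- hence none moved and `h = h₀`.
  · rintro rfl
    apply hne
    have hright : ∀ i, h (Sum.inr i) = false := by
      intro i
      by_contra hi
      rw [Bool.not_eq_false] at hi
      obtain ⟨j, hj⟩ := ColSet.exists_emb_eq ((hmemS' (T.emb i)).2 (Or.inr ⟨i, hi, rfl⟩))
      have := @hinj (Sum.inl j) (hl j (by rw [hj]; exact hr i hi)) (Sum.inr i) hi (by simpa [g])
      simp at this
    have hsub : (Finset.univ.filter fun j => h j = true) ⊆
        Finset.univ.map Function.Embedding.inl := by
      rintro (i | i) hi
      · simp
      · simp [hright] at hi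
    have heq := Finset.eq_of_subset_of_card_le hsub (by rw [hcard]; simp)
    funext j
    rcases j with j | j
    · have : Sum.inl j ∈ (Finset.univ.filter fun j => h j = true) := by rw [heq]; simp
      simpa [h₀] using this
    · simp [h₀, hright]

/-- The product of the maximal minors of `Y` on the sets of columns in a list. -/
def minorProd (Y : Matrix (Fin m) (Fin N) A) (l : List (ColSet m N)) : A :=
  (l.map (maxMinor Y)).prod

@[simp] theorem minorProd_nil (Y : Matrix (Fin m) (Fin N) A) : minorProd Y [] = 1 := rfl

@[simp] theorem minorProd_cons (Y : Matrix (Fin m) (Fin N) A) (S : ColSet m N)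
    (l : List (ColSet m N)) : minorProd Y (S :: l) = maxMinor Y S * minorProd Y l := by
  simp [minorProd]

theorem map_minorProd {B : Type*} [CommRing B] (f : A →+* B) (Y : Matrix (Fin m) (Fin N) A)
    (l : List (ColSet m N)) : f (minorProd Y l) = minorProd (Y.map f) l := by
  simp [minorProd, map_list_prod, List.map_map, Function.comp_def, map_maxMinor]

theorem minorProd_mul (P : Matrix (Fin m) (Fin m) A) (Y : Matrix (Fin m) (Fin N) A)
    (l : List (ColSet m N)) : minorProd (P * Y) l = P.det ^ l.length * minorProd Y l := by
  induction l with
  | nil => simp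
  | cons S l ih => simp [ih, maxMinor_mul, pow_succ]; ring

/-- The straightening law: a product of maximal minors is a combination of standard products of
as many factors, the first of which is at most the first factor of the given product. -/
theorem minorProd_mem_span_standard (k : Type*) [CommRing k] [Algebra k A]
    (Y : Matrix (Fin m) (Fin N) A) (n : ℕ) (S : ColSet m N) (l : List (ColSet m N))
    (hl : l.length = n) :
    minorProd Y (S :: l) ∈ Submodule.span k {x | ∃ S' l', S' ≤ S ∧ l'.length = n ∧
      (S' :: l').Pairwise (· ≤ ·) ∧ x = minorProd Y (S' :: l')} := by
  induction n generalizing S l with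
  | zero =>
    rw [List.length_eq_zero_iff] at hl
    subst hl
    exact Submodule.subset_span ⟨S, [], le_rfl, rfl, by simp, rfl⟩
  | succ n ih =>
    induction S using WellFoundedLT.induction generalizing l with
    | ind S ihS =>
    obtain ⟨T, l, rfl⟩ := List.exists_cons_of_length_eq_add_one hl
    rw [minorProd_cons]
    -- Straighten the tail first. If its new head is not above `S`, the exchange relation lowers `S`
    -- and the inner induction applies.
    have hT := ih T l (by simpa using hl)
    generalize minorProd Y (T :: l) = z at hT
    induction hT using Submodule.span_induction with
    | zero => simp
    | add x y _ _ hx hy => rw [mul_add]; exact Submodule.add_mem _ hx hy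
    | smul a x _ hx => rw [mul_smul_comm]; exact Submodule.smul_mem _ _ hx
    | mem x hx =>
      obtain ⟨T', l', -, hlen, hstd, rfl⟩ := hx
      by_cases hST : S ≤ T'
      · refine Submodule.subset_span ⟨S, T' :: l', le_rfl, by simp [hlen], ?_, by simp⟩
        rw [List.pairwise_cons]
        refine ⟨fun U hU => ?_, hstd⟩
        rcases List.mem_cons.1 hU with rfl | hU
        · exact hST
        · exact hST.trans ((List.pairwise_cons.1 hstd).1 U hU)
      · rw [minorProd_cons, ← mul_assoc]
        have hex := maxMinor_mul_maxMinor_mem_span k Y hST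
        generalize maxMinor Y S * maxMinor Y T' = z at hex
        induction hex using Submodule.span_induction with
        | zero => simp
        | add x y _ _ hx hy => rw [add_mul]; exact Submodule.add_mem _ hx hy
        | smul a x _ hx => rw [smul_mul_assoc]; exact Submodule.smul_mem _ _ hx
        | mem x hx =>
          obtain ⟨S', T'', hlt, rfl⟩ := hx
          have h := ihS S' hlt (T'' :: l') (by simp [hlen])
          rw [minorProd_cons, minorProd_cons, ← mul_assoc] at h
          refine Submodule.span_mono ?_ h
          rintro _ ⟨S₁, l₁, hle, hrest⟩
          exact ⟨S₁, l₁, hle.trans hlt.le, hrest⟩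

end maxMinor

/-! ### Echelon matrices and independence of standard products -/

section echelon

variable {m N : ℕ} (k : Type*) [CommRing k]

/-- The generic matrix whose `i`-th row is zero to the left of the `i`-th column in `D`. -/
noncomputable def genericEchelon (D : ColSet m N) :
    Matrix (Fin m) (Fin N) (MvPolynomial (Fin m × Fin N) k) :=
  Matrix.of fun i j => if (i : ℕ) < D.count (j + 1) then MvPolynomial.X (i, j) else 0

/-- The columns of `S` before `c` are supported on the rows whose pivot in `D` lies before `c`, and
these are too few. -/
theorem maxMinor_genericEchelon_eq_zero {D S : ColSet m N} (h : ¬ D ≤ S) :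
    maxMinor (genericEchelon k D) S = 0 := by
  obtain ⟨c, hc⟩ : ∃ c, D.count c < S.count c := by
    simpa [ColSet.le_def] using h
  refine Matrix.det_eq_zero_of_zero_block _ (Finset.univ.filter fun i => (D.emb i : ℕ) < c)
    (Finset.univ.filter fun i => (S.emb i : ℕ) < c) ?_ ?_
  · rwa [D.card_emb_lt, S.card_emb_lt]
  · intro i hi j hj
    simp only [Finset.mem_filter, Finset.mem_univ, true_and] at hi hj
    rw [← ColSet.lt_count_iff] at hi
    have hmono : D.count (S.emb j + 1) ≤ D.count c :=
      Finset.card_le_card (Finset.monotone_filter_right _ fun x _ hx => by omega)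
    simp only [genericEchelon, Matrix.submatrix_apply, Matrix.of_apply, id]
    rw [if_neg (by omega)]

theorem maxMinor_genericEchelon_ne_zero [Nontrivial k] {D S : ColSet m N} (h : D ≤ S) :
    maxMinor (genericEchelon k D) S ≠ 0 := by
  intro h0
  let f : MvPolynomial (Fin m × Fin N) k →+* k :=
    (MvPolynomial.aeval (R := k) fun x : Fin m × Fin N => if x.2 = S.emb x.1 then (1 : k) else 0).toRingHom
  have h1 : f (maxMinor (genericEchelon k D) S) = 1 := by
    rw [map_maxMinor, maxMinor, ← Matrix.det_one (n := Fin m)]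
    congr 1
    ext i j
    by_cases hij : i = j
    · subst hij
      have h2 : (i : ℕ) < D.count (S.emb i + 1) := by
        have h3 := S.count_succ (S.emb i)
        rw [S.count_emb, if_pos (S.emb_mem i)] at h3
        have := h (S.emb i + 1)
        omega
      simp [genericEchelon, f, h2]
    · have : S.emb j ≠ S.emb i := fun h => hij (S.emb.injective h).symm
      simp only [genericEchelon, f, Matrix.submatrix_apply, Matrix.map_apply, Matrix.of_apply, id,
        Matrix.one_apply_ne hij]
      split_ifs <;> simp [this]
  rw [h0, map_zero] at h1
  exact zero_ne_one h1

/-- A larger column set forces more zeros, so relations specialise upwards. -/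
theorem exists_genericEchelon_map_eq {D S : ColSet m N} (h : D ≤ S) :
    ∃ f : MvPolynomial (Fin m × Fin N) k →ₐ[k] MvPolynomial (Fin m × Fin N) k,
      (genericEchelon k D).map f = genericEchelon k S := by
  refine ⟨MvPolynomial.aeval fun x => genericEchelon k S x.1 x.2, ?_⟩
  ext1 i j
  have := h (j + 1)
  by_cases hi : (i : ℕ) < S.count (j + 1)
  · simp [genericEchelon, hi, hi.trans_le this]
  · by_cases hD : (i : ℕ) < D.count (j + 1) <;> simp [genericEchelon, hi, hD]

variable {k}

/-- If a combination of standard products of minors vanishes on the generic echelon matrices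
outside a lower set, then the first factors of these products belong to the lower set. -/
theorem head_mem_of_linearCombination_eq_zero [IsDomain k] (n : ℕ) (Ω : Set (ColSet m N))
    (hΩ : IsLowerSet Ω) (c : List (ColSet m N) →₀ k)
    (hc : ∀ l ∈ c.support, l.length = n + 1 ∧ l.Pairwise (· ≤ ·))
    (h0 : ∀ D ∉ Ω, Finsupp.linearCombination k (minorProd (genericEchelon k D)) c = 0)
    (S : ColSet m N) (l : List (ColSet m N)) (hl : S :: l ∈ c.support) : S ∈ Ω := by
  induction n using Nat.strong_induction_on generalizing Ω c S l with
  | _ n ih =>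
  by_contra hS
  -- On the echelon matrix of a maximal offending head `D`, only products with head `D` survive:
  -- heads not above `D` vanish, and those strictly above are excluded by maximality. The nonzero
  -- minor on `D` can then be cancelled.
  obtain ⟨D, hD⟩ := (Set.toFinite {T | T ∉ Ω ∧ ∃ l', T :: l' ∈ c.support}).exists_maximal
    ⟨S, hS, l, hl⟩
  obtain ⟨⟨hDΩ, l₀, hl₀⟩, hmax⟩ := hD
  have hinj : Function.Injective (List.cons D) := List.cons_injective
  let c' := c.comapDomain (List.cons D) hinj.injOn
  have hc' : ∀ l' ∈ c'.support, D :: l' ∈ c.support := by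
    intro l' hl'
    simpa [c'] using hl'
  have hfactor : maxMinor (genericEchelon k D) D *
      Finsupp.linearCombination k (minorProd (genericEchelon k D)) c' = 0 := by
    rw [← h0 D hDΩ, Finsupp.linearCombination_apply, Finsupp.linearCombination_apply, Finsupp.sum,
      Finsupp.sum, Finsupp.comapDomain_support, Finset.mul_sum,
      ← Finset.sum_preimage (List.cons D) c.support hinj.injOn]
    · simp [c']
    · intro l' hl' hrange
      obtain ⟨T, l', rfl⟩ := List.exists_cons_of_length_eq_add_one (hc l' hl').1
      have hDT : ¬ D ≤ T := by
        intro hDT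
        have := hmax ⟨fun hT => hDΩ (hΩ hDT hT), l', hl'⟩ hDT
        rw [le_antisymm hDT this] at hrange
        exact hrange ⟨l', rfl⟩
      rw [minorProd_cons, maxMinor_genericEchelon_eq_zero k hDT, zero_mul, smul_zero]
  have hzero := (mul_eq_zero.1 hfactor).resolve_left (maxMinor_genericEchelon_ne_zero k le_rfl)
  have hl₀' : l₀ ∈ c'.support := by simpa [c'] using hl₀
  cases n with
  | zero =>
    have hsub : c'.support ⊆ {[]} := by
      intro l' hl'
      simpa using (hc _ (hc' l' hl')).1
    obtain ⟨b, hb⟩ := Finsupp.support_subset_singleton'.1 hsub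
    rw [hb, Finsupp.linearCombination_single, minorProd_nil, smul_eq_zero] at hzero
    rw [hb, hzero.resolve_right one_ne_zero] at hl₀'
    simp at hl₀'
  | succ n =>
    obtain ⟨T, l₁, rfl⟩ := List.exists_cons_of_length_eq_add_one
      (show l₀.length = n + 1 by simpa using (hc _ hl₀).1)
    have hDT : D ≤ T := (List.pairwise_cons.1 (hc _ hl₀).2).1 T (by simp)
    -- The relation among tails specialises to every `E ≥ D`. By induction the tails have heads not
    -- above `D`, contradicting standardness.
    refine ih n (Nat.lt_succ_self n) {T | ¬ D ≤ T} (fun T U hUT hT hDU => hT (hDU.trans hUT)) c'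
      (fun l' hl' => ?_) (fun E hE => ?_) T l₁ hl₀' hDT
    · have := hc _ (hc' l' hl')
      exact ⟨by simpa using this.1, (List.pairwise_cons.1 this.2).2⟩
    · obtain ⟨f, hf⟩ := exists_genericEchelon_map_eq k (not_not.1 hE)
      have := congrArg f hzero
      rw [map_zero, Finsupp.linearCombination_apply, map_finsuppSum] at this
      rw [← this, Finsupp.linearCombination_apply]
      refine Finsupp.sum_congr fun l' _ => ?_
      rw [map_smul]
      congr 1
      have := map_minorProd f.toRingHom (genericEchelon k D) l'
      exact (this.trans (congrArg (minorProd · l') hf)).symm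

end echelon

/-! ### Minors of `X` as maximal minors of `(X 1)` -/

section augment

variable {m n : ℕ} {A : Type*} [CommRing A]

/-- The matrix `(X 1)`. -/
def augment (X : Matrix (Fin m) (Fin n) A) : Matrix (Fin m) (Fin (n + m)) A :=
  Matrix.of fun i => Fin.append (X i) ((1 : Matrix (Fin m) (Fin m) A) i)

@[simp] theorem augment_castAdd (X : Matrix (Fin m) (Fin n) A) (i : Fin m) (j : Fin n) :
    augment X i (Fin.castAdd m j) = X i j := by simp [augment]

@[simp] theorem augment_natAdd (X : Matrix (Fin m) (Fin n) A) (i j : Fin m) :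
    augment X i (Fin.natAdd n j) = (1 : Matrix (Fin m) (Fin m) A) i j := by simp [augment]

theorem augment_map {B : Type*} [CommRing B] (f : A →+* B) (X : Matrix (Fin m) (Fin n) A) :
    (augment X).map f = augment (X.map f) := by
  ext i j
  refine Fin.addCases (fun j => ?_) (fun j => ?_) j
  · simp
  · simp [Matrix.one_apply, apply_ite f]

theorem augment_submatrix_inv_mul (Y : Matrix (Fin m) (Fin (n + m)) A)
    (hY : IsUnit (Y.submatrix id (Fin.natAdd n)).det) :
    augment (((Y.submatrix id (Fin.natAdd n))⁻¹ * Y).submatrix id (Fin.castAdd m)) =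
      (Y.submatrix id (Fin.natAdd n))⁻¹ * Y := by
  ext i j
  refine Fin.addCases (fun j => ?_) (fun j => ?_) j
  · simp
  · rw [augment_natAdd, ← Matrix.nonsing_inv_mul _ hY]
    rfl

/-- The set of the last `m` of `n + m` columns. -/
def ColSet.last (m n : ℕ) : ColSet m (n + m) :=
  ⟨Finset.univ.image (Fin.natAdd n), by
    simp [Finset.card_image_of_injective _ (Fin.natAdd_injective m n)]⟩

theorem ColSet.emb_last (i : Fin m) : (ColSet.last m n).emb i = Fin.natAdd n i := by
  have := Finset.orderEmbOfFin_unique (ColSet.last m n).2 (f := Fin.natAdd n)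
    (fun x => by simp [ColSet.last]) (Fin.strictMono_natAdd n)
  exact (congrFun this i).symm

theorem ColSet.le_of_emb_le {N : ℕ} {S T : ColSet m N} (h : ∀ i, S.emb i ≤ T.emb i) : S ≤ T := by
  intro c
  rw [← S.card_emb_lt, ← T.card_emb_lt]
  refine Finset.card_le_card fun i hi => ?_
  simp only [Finset.mem_filter, Finset.mem_univ, true_and] at hi ⊢
  have := h i
  rw [Fin.le_def] at this
  omega

theorem ColSet.le_last (S : ColSet m (n + m)) : S ≤ ColSet.last m n := by
  refine ColSet.le_of_emb_le fun i => ?_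
  rw [ColSet.emb_last, Fin.le_def, Fin.val_natAdd]
  have h : (Finset.Ioi i).map S.emb.toEmbedding ⊆ Finset.Ioi (S.emb i) := by
    intro x hx
    obtain ⟨j, hj, rfl⟩ := Finset.mem_map.1 hx
    simpa using hj
  have := Finset.card_le_card h
  rw [Finset.card_map, Fin.card_Ioi, Fin.card_Ioi] at this
  omega

theorem maxMinor_augment_last (X : Matrix (Fin m) (Fin n) A) :
    maxMinor (augment X) (ColSet.last m n) = 1 := by
  rw [maxMinor, ← Matrix.det_one (n := Fin m)]
  congr 1
  ext i j
  simp [ColSet.emb_last]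

/-- Adjoin the unit columns of the unused rows: the matrix becomes block triangular, and the new
columns all lie beyond the first `n`. -/
theorem exists_det_submatrix_eq_maxMinor_augment (X : Matrix (Fin m) (Fin n) A) {t : ℕ}
    (rows : Fin t ↪o Fin m) (cols : Fin t ↪o Fin n) :
    ∃ (S : ColSet m (n + m)) (ε : ℤˣ),
      (X.submatrix rows cols).det = ε • maxMinor (augment X) S ∧
      ∀ c ≤ n, S.count c = (Finset.univ.filter fun i => (cols i : ℕ) < c).card := by
  classical
  let e : Fin t ⊕ ((Set.range rows)ᶜ : Set (Fin m)) ≃ Fin m :=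
    ((Equiv.ofInjective rows rows.injective).sumCongr (Equiv.refl _)).trans
      (Equiv.Set.sumCompl (Set.range rows))
  let G : Fin t ⊕ ((Set.range rows)ᶜ : Set (Fin m)) → Fin (n + m) :=
    Sum.elim (fun i => Fin.castAdd m (cols i)) (fun i => Fin.natAdd n i.1)
  have hG : Function.Injective G := by
    refine Function.Injective.sumElim (fun i j hij => ?_) (fun i j hij => ?_) fun i j hij => ?_
    · simpa using hij
    · exact Subtype.ext (Fin.natAdd_injective m n hij)
    · have := congrArg Fin.val hij
      simp only [Fin.val_castAdd, Fin.val_natAdd] at this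
      have := (cols i).2
      omega
  have hblock : ((augment X).submatrix id fun i => G (e.symm i)).submatrix e e =
      Matrix.fromBlocks (X.submatrix rows cols) 0
        (X.submatrix (fun i : ((Set.range rows)ᶜ : Set (Fin m)) => i.1) cols) 1 := by
    have hl : ∀ i, e (Sum.inl i) = rows i := fun _ => rfl
    have hr : ∀ i, e (Sum.inr i) = i.1 := fun _ => rfl
    have hl' : ∀ i, e.symm (rows i) = Sum.inl i := fun i => by rw [← hl, e.symm_apply_apply]
    have hr' : ∀ i : ((Set.range rows)ᶜ : Set (Fin m)), e.symm i.1 = Sum.inr i := fun i => by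
      rw [← hr, e.symm_apply_apply]
    ext (i | i) (j | j) <;>
      simp only [Matrix.submatrix_apply, id, hl, hr, hl', hr', G, Sum.elim_inl,
        Sum.elim_inr, augment_castAdd, augment_natAdd, Matrix.fromBlocks_apply₁₁,
        Matrix.fromBlocks_apply₁₂, Matrix.fromBlocks_apply₂₁, Matrix.fromBlocks_apply₂₂]
    · exact Matrix.one_apply_ne fun h => j.2 ⟨i, h⟩
    · simp [Matrix.one_apply, Subtype.ext_iff]
  have hdet : ((augment X).submatrix id fun i => G (e.symm i)).det =
      (X.submatrix rows cols).det := by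
    rw [← Matrix.det_submatrix_equiv_self e, hblock, Matrix.det_fromBlocks_zero₁₂,
      Matrix.det_one, mul_one]
  have hinj : Function.Injective fun i => G (e.symm i) := hG.comp e.symm.injective
  obtain ⟨ε, hε⟩ := det_submatrix_eq_maxMinor (augment X) hinj
  refine ⟨_, ε, hdet.symm.trans hε, fun c hc => ?_⟩
  have hcc : Function.Injective fun i => Fin.castAdd m (cols i) :=
    (Fin.castAdd_injective n m).comp cols.injective
  rw [← Finset.card_image_of_injective _ hcc]
  change (Finset.filter _ (Finset.univ.image fun i => G (e.symm i))).card = _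
  congr 1
  ext x
  simp only [Finset.mem_filter, Finset.mem_image, Finset.mem_univ, true_and]
  constructor
  · rintro ⟨⟨i, rfl⟩, hx⟩
    obtain ⟨j, rfl⟩ := e.surjective i
    rw [e.symm_apply_apply] at hx ⊢
    rcases j with j | j
    · exact ⟨j, hx, rfl⟩
    · simp only [G, Sum.elim_inr, Fin.val_natAdd] at hx
      omega
  · rintro ⟨j, hj, rfl⟩
    exact ⟨⟨e (Sum.inl j), by simp [G]⟩, hj⟩

/-- Repeated Laplace expansion along the last column. -/
theorem det_submatrix_mem_of_forall_mem {N : ℕ} (J : Ideal A) (M : Matrix (Fin m) (Fin N) A)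
    {t s : ℕ} (hts : t ≤ s) (g : Fin s → Fin N)
    (h : ∀ rows : Fin t ↪o Fin m, (M.submatrix rows fun i => g (Fin.castLE hts i)).det ∈ J)
    (rows : Fin s ↪o Fin m) : (M.submatrix rows g).det ∈ J := by
  induction s, hts using Nat.le_induction with
  | base => exact h rows
  | succ s hts ih =>
    rw [Matrix.det_succ_column _ (Fin.last s)]
    refine Ideal.sum_mem _ fun i _ => Ideal.mul_mem_left _ _ ?_
    have := ih (fun j => g j.castSucc) h (i.succAboveOrderEmb.trans rows)
    convert this using 2
    ext x y
    simp

/-- The first `t` columns of `S` lie in `X` and the first `r` of these in `A`; Laplace expansion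
along the remaining columns leaves `t`-minors on these. -/
theorem maxMinor_augment_mem (J : Ideal A) (X : Matrix (Fin m) (Fin n) A) {a t r : ℕ}
    (hrt : r ≤ t) (hJ : ∀ (rows : Fin t ↪o Fin m) (cols : Fin t ↪o Fin n),
      r ≤ (Finset.univ.filter fun i => (cols i : ℕ) < a).card → (X.submatrix rows cols).det ∈ J)
    (S : ColSet m (n + m)) (ht : t ≤ S.count n) (hr : r ≤ S.count a) :
    maxMinor (augment X) S ∈ J := by
  have htm : t ≤ m := ht.trans (S.count_le n)
  refine det_submatrix_mem_of_forall_mem J (augment X) htm S.emb (fun rows => ?_)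
    (RelEmbedding.refl _)
  have hlt : ∀ i : Fin t, (S.emb (Fin.castLE htm i) : ℕ) < n := by
    intro i
    rw [← ColSet.lt_count_iff, Fin.val_castLE]
    omega
  let cols : Fin t ↪o Fin n := OrderEmbedding.ofStrictMono
    (fun i => ⟨S.emb (Fin.castLE htm i), hlt i⟩) (fun i j hij => by simpa using hij)
  have hmem := hJ rows cols ?_
  · convert hmem using 2
    ext i j
    have : S.emb (Fin.castLE htm j) = Fin.castAdd m (cols j) := rfl
    simp [this]
  · have : Finset.univ.map (Fin.castLEEmb hrt) ⊆
        Finset.univ.filter fun i => (cols i : ℕ) < a := by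
      intro i hi
      obtain ⟨x, -, rfl⟩ := Finset.mem_map.1 hi
      simp only [Finset.mem_filter, Finset.mem_univ, true_and]
      change (S.emb (Fin.castLE htm (Fin.castLE hrt x)) : ℕ) < a
      rw [← ColSet.lt_count_iff, Fin.val_castLE, Fin.val_castLE]
      omega
    simpa using Finset.card_le_card this

end augment

/-! ### The generic matrix: spanning products and echelon specialisations -/

section generic

variable {m n : ℕ} (k : Type*)

/-- Variables are themselves maximal minors of `(X 1)` up to sign, so polynomial coefficients can be
absorbed into the products. -/
theorem exists_mem_span_minorProd_of_mem_minorIdeal [CommRing k] {t : ℕ}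
    {f : MvPolynomial (Fin m × Fin n) k}
    (hf : f ∈ minorIdeal (Matrix.mvPolynomialX (Fin m) (Fin n) k) (t : ℤ)) :
    ∃ L, f ∈ Submodule.span k {x | ∃ S l, t ≤ ColSet.count S n ∧ l.length = L ∧
      x = minorProd (augment (Matrix.mvPolynomialX (Fin m) (Fin n) k)) (S :: l)} := by
  set Y := augment (Matrix.mvPolynomialX (Fin m) (Fin n) k) with hY
  let V : ℕ → Submodule k (MvPolynomial (Fin m × Fin n) k) := fun L =>
    Submodule.span k {x | ∃ S l, t ≤ ColSet.count S n ∧ l.length = L ∧ x = minorProd Y (S :: l)}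
  have hmul : ∀ L T x, x ∈ V L → x * maxMinor Y T ∈ V (L + 1) := by
    intro L T x hx
    induction hx using Submodule.span_induction with
    | zero => simp
    | add x y _ _ hx hy => rw [add_mul]; exact Submodule.add_mem _ hx hy
    | smul a x _ hx => rw [smul_mul_assoc]; exact Submodule.smul_mem _ _ hx
    | mem x hx =>
      obtain ⟨S, l, hS, hl, rfl⟩ := hx
      refine Submodule.subset_span ⟨S, T :: l, hS, by simp [hl], ?_⟩
      simp only [minorProd_cons]
      ring
  -- The minor on the last `m` columns is `1`, so products can be padded to a common length.
  have hmono : Monotone V := monotone_nat_of_le_succ fun L x hx => by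
    simpa [hY, maxMinor_augment_last] using hmul L (ColSet.last m n) x hx
  have hadd : ∀ x y, (∃ L, x ∈ V L) → (∃ L, y ∈ V L) → ∃ L, x + y ∈ V L := by
    rintro x y ⟨L, hx⟩ ⟨L', hy⟩
    exact ⟨max L L', Submodule.add_mem _ (hmono (le_max_left _ _) hx)
      (hmono (le_max_right _ _) hy)⟩
  have hX : ∀ x p, (∃ L, x ∈ V L) → ∃ L, x * MvPolynomial.X p ∈ V L := by
    rintro x ⟨i, j⟩ ⟨L, hx⟩
    let rows : Fin 1 ↪o Fin m := OrderEmbedding.ofStrictMono (fun _ => i) (Subsingleton.strictMono _)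
    let cols : Fin 1 ↪o Fin n := OrderEmbedding.ofStrictMono (fun _ => j) (Subsingleton.strictMono _)
    obtain ⟨S, ε, hS, -⟩ := exists_det_submatrix_eq_maxMinor_augment
      (Matrix.mvPolynomialX (Fin m) (Fin n) k) rows cols
    rw [Matrix.det_fin_one, Matrix.submatrix_apply, Matrix.mvPolynomialX_apply,
      Units.smul_def] at hS
    refine ⟨L + 1, ?_⟩
    change x * MvPolynomial.X (rows 0, cols 0) ∈ V (L + 1)
    rw [hS, mul_smul_comm]
    exact zsmul_mem (hmul L S x hx) _
  have hsmul : ∀ g x : MvPolynomial (Fin m × Fin n) k, (∃ L, x ∈ V L) → ∃ L, g * x ∈ V L := by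
    intro g
    induction g using MvPolynomial.induction_on with
    | C a =>
      rintro x ⟨L, hx⟩
      exact ⟨L, by rw [← MvPolynomial.smul_eq_C_mul]; exact Submodule.smul_mem _ _ hx⟩
    | add p q hp hq =>
      intro x hx
      rw [add_mul]
      exact hadd _ _ (hp x hx) (hq x hx)
    | mul_X p i hp =>
      intro x hx
      rw [mul_right_comm]
      exact hX _ _ (hp x hx)
  change ∃ L, f ∈ V L
  rw [minorIdeal, Int.toNat_natCast] at hf
  induction hf using Submodule.span_induction with
  | zero => exact ⟨0, Submodule.zero_mem _⟩
  | add x y _ _ hx hy => exact hadd _ _ hx hy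
  | smul g x _ hx => exact hsmul g x hx
  | mem x hx =>
    obtain ⟨rows, cols, rfl⟩ := hx
    obtain ⟨S, ε, hS, hcount⟩ := exists_det_submatrix_eq_maxMinor_augment
      (Matrix.mvPolynomialX (Fin m) (Fin n) k) rows cols
    refine ⟨0, ?_⟩
    rw [hS, Units.smul_def]
    refine zsmul_mem (Submodule.subset_span ?_) _
    refine ⟨S, [], ?_, rfl, by simp [hY]⟩
    rw [hcount n le_rfl]
    simp

/-- The last `m` columns of the echelon matrix are invertible over the fraction field, since `D`
lies below the last column set. Normalising them to `1` gives a specialisation of `(X 1)`. -/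
theorem exists_augment_map_eq_mul_genericEchelon [Field k] (D : ColSet m (n + m)) :
    ∃ (φ : MvPolynomial (Fin m × Fin n) k →ₐ[k]
        FractionRing (MvPolynomial (Fin m × Fin (n + m)) k)) (P : Matrix (Fin m) (Fin m)
        (FractionRing (MvPolynomial (Fin m × Fin (n + m)) k))),
      P.det ≠ 0 ∧ (augment (Matrix.mvPolynomialX (Fin m) (Fin n) k)).map φ =
        P * (genericEchelon k D).map (algebraMap (MvPolynomial (Fin m × Fin (n + m)) k)
          (FractionRing (MvPolynomial (Fin m × Fin (n + m)) k))) := by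
  let K := FractionRing (MvPolynomial (Fin m × Fin (n + m)) k)
  let Y : Matrix (Fin m) (Fin (n + m)) K := (genericEchelon k D).map (algebraMap _ _)
  have hdet : (Y.submatrix id (Fin.natAdd n)).det ≠ 0 := by
    have h := maxMinor_genericEchelon_ne_zero k D.le_last
    have hemb : (ColSet.last m n).emb = (Fin.natAdd n : Fin m → Fin (n + m)) :=
      funext ColSet.emb_last
    have h1 : (Y.submatrix id (Fin.natAdd n)).det =
        algebraMap _ K (maxMinor (genericEchelon k D) (ColSet.last m n)) := by
      rw [map_maxMinor, maxMinor, hemb]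
    rw [h1]
    exact fun h0 => h ((IsFractionRing.to_map_eq_zero_iff (K := K)).1 h0)
  refine ⟨MvPolynomial.aeval fun x =>
    ((Y.submatrix id (Fin.natAdd n))⁻¹ * Y) x.1 (Fin.castAdd m x.2),
    (Y.submatrix id (Fin.natAdd n))⁻¹, ?_, ?_⟩
  · rw [Matrix.det_nonsing_inv, Ring.inverse_eq_inv']
    exact inv_ne_zero hdet
  · refine ((augment_map (AlgHom.toRingHom _) _).trans ?_).trans
      (augment_submatrix_inv_mul Y (IsUnit.mk0 _ hdet))
    congr 1
    ext i j
    simp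

end generic

/-! ### The intersection of the two ideals, and degrees of minors -/

section generic

variable {m n : ℕ} (k : Type*)

theorem map_eq_zero_of_mem_minorIdeal_leftBlock {A B : Type*} [CommRing A] [CommRing B] {a : ℕ}
    (ha : a ≤ n) (r : ℤ) (X : Matrix (Fin m) (Fin n) A) (φ : A →+* B)
    (hφ : ∀ S : ColSet m (n + m), r.toNat ≤ S.count a → φ (maxMinor (augment X) S) = 0)
    {f : A} (hf : f ∈ minorIdeal (leftBlock ha X) r) : φ f = 0 := by
  suffices h : minorIdeal (leftBlock ha X) r ≤ RingHom.ker φ from h hf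
  rw [minorIdeal, Ideal.span_le]
  rintro _ ⟨rows, cols, rfl⟩
  obtain ⟨S, ε, hS, hcount⟩ := exists_det_submatrix_eq_maxMinor_augment X rows
    (cols.trans (Fin.castLEOrderEmb ha))
  have h : r.toNat ≤ S.count a := by
    rw [hcount a ha]
    simp
  change φ (X.submatrix rows (cols.trans (Fin.castLEOrderEmb ha))).det = 0
  rw [hS, Units.smul_def, map_zsmul, hφ S h, smul_zero]

theorem mem_of_mem_minorIdeal_inf [Field k] {a t : ℕ} (ha : a ≤ n) (r : ℤ) (hrt : r ≤ t)
    (J : Ideal (MvPolynomial (Fin m × Fin n) k))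
    (hJ : ∀ (rows : Fin t ↪o Fin m) (cols : Fin t ↪o Fin n),
      r ≤ (Finset.univ.filter fun i => (cols i : ℕ) < a).card →
      ((Matrix.mvPolynomialX (Fin m) (Fin n) k).submatrix rows cols).det ∈ J)
    {f : MvPolynomial (Fin m × Fin n) k}
    (hft : f ∈ minorIdeal (Matrix.mvPolynomialX (Fin m) (Fin n) k) (t : ℤ))
    (hfr : f ∈ minorIdeal (leftBlock ha (Matrix.mvPolynomialX (Fin m) (Fin n) k)) r) :
    f ∈ J := by
  set X := Matrix.mvPolynomialX (Fin m) (Fin n) k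
  obtain ⟨L, hL⟩ := exists_mem_span_minorProd_of_mem_minorIdeal k hft
  let s : Set (List (ColSet m (n + m))) :=
    {l | l.length = L + 1 ∧ l.Pairwise (· ≤ ·) ∧ ∀ S l', l = S :: l' → t ≤ S.count n}
  have hs : f ∈ Submodule.span k (minorProd (augment X) '' s) := by
    refine Submodule.span_le.2 ?_ hL
    rintro _ ⟨S, l, hS, hl, rfl⟩
    refine Submodule.span_mono ?_ (minorProd_mem_span_standard k (augment X) L S l hl)
    rintro _ ⟨S', l', hle, hl', hstd, rfl⟩
    refine ⟨S' :: l', ⟨by simp [hl'], hstd, ?_⟩, rfl⟩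
    rintro T l'' h
    obtain ⟨rfl, -⟩ := List.cons.inj h
    exact hS.trans (hle n)
  obtain ⟨c, hc, rfl⟩ := (Finsupp.mem_span_image_iff_linearCombination k).1 hs
  rw [Finsupp.mem_supported] at hc
  let Ω : Set (ColSet m (n + m)) := {S | r.toNat ≤ S.count a}
  have hΩ : ∀ S l, S :: l ∈ c.support → S ∈ Ω := by
    refine head_mem_of_linearCombination_eq_zero L Ω (fun S T hTS hS => hS.trans (hTS a)) c
      (fun l hl => ⟨(hc hl).1, (hc hl).2.1⟩) fun D hD => ?_
    obtain ⟨φ, P, hP, hφ⟩ := exists_augment_map_eq_mul_genericEchelon k D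
    have hzero := map_eq_zero_of_mem_minorIdeal_leftBlock ha r X φ.toRingHom (fun S hS => ?_) hfr
    -- All products have length `L + 1`, so the normalising matrix contributes one common nonzero
    -- factor.
    · have hprod : ∀ l ∈ c.support, φ (minorProd (augment X) l) =
          P.det ^ (L + 1) * algebraMap _ _ (minorProd (genericEchelon k D) l) := by
        intro l hl
        refine (map_minorProd φ.toRingHom _ l).trans ?_
        refine (congrArg (minorProd · l) hφ).trans ?_
        rw [minorProd_mul, (hc hl).1, map_minorProd]
      have hmap : φ (Finsupp.linearCombination k (minorProd (augment X)) c) =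
          P.det ^ (L + 1) * algebraMap _ _
            (Finsupp.linearCombination k (minorProd (genericEchelon k D)) c) := by
        rw [Finsupp.linearCombination_apply, Finsupp.linearCombination_apply, Finsupp.sum,
          Finsupp.sum, map_sum, map_sum, Finset.mul_sum]
        refine Finset.sum_congr rfl fun l hl => ?_
        rw [map_smul, hprod l hl, Algebra.algebraMap_eq_smul_one (c l • _), smul_assoc,
          ← Algebra.algebraMap_eq_smul_one, mul_smul_comm]
      have h := (mul_eq_zero.1 (hmap.symm.trans hzero)).resolve_left (pow_ne_zero _ hP)
      exact (IsFractionRing.to_map_eq_zero_iff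
        (K := FractionRing (MvPolynomial (Fin m × Fin (n + m)) k))).1 h
    · have hDS : ¬ D ≤ S := fun h => hD (hS.trans (h a))
      refine (map_maxMinor φ.toRingHom _ S).trans ?_
      refine (congrArg (maxMinor · S) hφ).trans ?_
      rw [maxMinor_mul, ← map_maxMinor, maxMinor_genericEchelon_eq_zero k hDS, map_zero, mul_zero]
  rw [Finsupp.linearCombination_apply]
  refine Ideal.sum_mem _ fun l hl => ?_
  obtain ⟨S, l', rfl⟩ := List.exists_cons_of_length_eq_add_one (hc hl).1
  change _ • minorProd _ _ ∈ J
  rw [minorProd_cons]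
  refine Submodule.smul_of_tower_mem _ _ (Ideal.mul_mem_right _ _ ?_)
  refine maxMinor_augment_mem J X (r := r.toNat) (by omega) (fun rows cols h => ?_) S
    ((hc hl).2.2 S l' rfl) (hΩ S l' hl)
  exact hJ rows cols (by omega)

theorem det_submatrix_mvPolynomialX_ne_zero [CommRing k] [Nontrivial k] {t : ℕ}
    (rows : Fin t ↪o Fin m) (cols : Fin t ↪o Fin n) :
    ((Matrix.mvPolynomialX (Fin m) (Fin n) k).submatrix rows cols).det ≠ 0 := by
  intro h0
  let f : MvPolynomial (Fin m × Fin n) k →ₐ[k] k := MvPolynomial.aeval fun x =>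
    if ∃ i, x = (rows i, cols i) then 1 else 0
  have h1 : f ((Matrix.mvPolynomialX (Fin m) (Fin n) k).submatrix rows cols).det = 1 := by
    rw [AlgHom.map_det, ← Matrix.det_one (n := Fin t)]
    congr 1
    ext i j
    simp only [f, AlgHom.mapMatrix_apply, Matrix.map_apply, Matrix.submatrix_apply,
      Matrix.mvPolynomialX_apply, MvPolynomial.aeval_X, Matrix.one_apply, Prod.mk.injEq,
      EmbeddingLike.apply_eq_iff_eq]
    simp [eq_comm]
  rw [h0, map_zero] at h1
  exact zero_ne_one h1

theorem isWeightedHomogeneous_det_submatrix [CommRing k] (a : ℕ) (p q : ℤ) {t : ℕ}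
    (rows : Fin t ↪o Fin m) (cols : Fin t ↪o Fin n) :
    MvPolynomial.IsWeightedHomogeneous (blockDegree m n a p q)
      ((Matrix.mvPolynomialX (Fin m) (Fin n) k).submatrix rows cols).det
      (t * q - (Finset.univ.filter fun i => (cols i : ℕ) < a).card * (q - p)) := by
  have hdeg : (t * q - (Finset.univ.filter fun i => (cols i : ℕ) < a).card * (q - p) : ℤ) =
      ∑ i, if (cols i : ℕ) < a then p else q := by
    have : ∀ i, (if (cols i : ℕ) < a then p else q) =
        q - (if (cols i : ℕ) < a then 1 else 0) * (q - p) := by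
      intro i
      split_ifs <;> ring
    simp only [this, Finset.sum_sub_distrib, ← Finset.sum_mul, Finset.sum_boole]
    simp
  rw [hdeg, Matrix.det_apply, ← MvPolynomial.mem_weightedHomogeneousSubmodule]
  refine Submodule.sum_mem _ fun σ _ => ?_
  rw [Units.smul_def]
  refine zsmul_mem ?_ _
  rw [MvPolynomial.mem_weightedHomogeneousSubmodule]
  exact MvPolynomial.IsWeightedHomogeneous.prod _ _ _ fun i _ =>
    MvPolynomial.isWeightedHomogeneous_X k (blockDegree m n a p q) (rows (σ i), cols i)

/-- The minor is nonzero, so its degree is unique; solving the inequality for the integral column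
count produces the ceiling. -/
theorem exists_isWeightedHomogeneous_det_le_iff [CommRing k] [Nontrivial k] (a : ℕ) {p q : ℤ}
    (hpq : p < q) {t : ℕ} (d : ℤ) (rows : Fin t ↪o Fin m) (cols : Fin t ↪o Fin n) :
    (∃ e : ℤ, MvPolynomial.IsWeightedHomogeneous (blockDegree m n a p q)
      ((Matrix.mvPolynomialX (Fin m) (Fin n) k).submatrix rows cols).det e ∧ e ≤ d) ↔
    ⌈((t : ℚ) * (q : ℚ) - (d : ℚ)) / ((q : ℚ) - (p : ℚ))⌉ ≤
      ((Finset.univ.filter fun i => (cols i : ℕ) < a).card : ℤ) := by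
  have hhom := isWeightedHomogeneous_det_submatrix k a p q rows cols
  have hpos : (0 : ℚ) < (q : ℚ) - (p : ℚ) := sub_pos.2 (Int.cast_lt.2 hpq)
  rw [Int.ceil_le, div_le_iff₀ hpos]
  set b : ℤ := ((Finset.univ.filter fun i => (cols i : ℕ) < a).card : ℤ)
  have hcast : ((t : ℚ) * (q : ℚ) - (d : ℚ) ≤ (b : ℚ) * ((q : ℚ) - (p : ℚ))) ↔
      (t * q - d ≤ b * (q - p)) := by exact_mod_cast Iff.rfl
  rw [hcast]
  constructor
  · rintro ⟨e, he, hed⟩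
    have := MvPolynomial.IsWeightedHomogeneous.inj_right
      (det_submatrix_mvPolynomialX_ne_zero k rows cols) he hhom
    linarith
  · intro h
    exact ⟨_, hhom, by linarith⟩

end generic

theorem mainTheorem8 {k : Type*} [Field k] (m n a : ℕ) (ha : a ≤ n)
    (p q : ℤ) (hpq : p < q) (t : ℕ) (d r : ℤ)
    (hr : r = ⌈((t : ℚ) * (q : ℚ) - (d : ℚ)) / ((q : ℚ) - (p : ℚ))⌉)
    (hrt : r ≤ (t : ℤ) ∨ (min m a : ℤ) < r) :
    lowDegreeMinorIdeal k m n a p q t d =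
      minorIdeal (Matrix.mvPolynomialX (Fin m) (Fin n) k) (t : ℤ) ⊓
        minorIdeal (leftBlock ha (Matrix.mvPolynomialX (Fin m) (Fin n) k)) r := by
  refine le_antisymm (le_inf ?_ ?_) ?_
  · rw [minorIdeal, Int.toNat_natCast]
    exact Ideal.span_mono fun f hf => hf.1
  · rw [lowDegreeMinorIdeal, Ideal.span_le]
    rintro _ ⟨⟨rows, cols, rfl⟩, hdeg⟩
    rw [exists_isWeightedHomogeneous_det_le_iff k a hpq, ← hr] at hdeg
    have hcard := Finset.card_filter_le (Finset.univ : Finset (Fin t)) fun i => (cols i : ℕ) < a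
    rw [Finset.card_univ, Fintype.card_fin] at hcard
    have hle : r.toNat ≤ t := by omega
    -- The columns increase, so those in `A` come first.
    have hlt : ∀ i : Fin r.toNat, (cols (Fin.castLE hle i) : ℕ) < a := by
      intro i
      by_contra hi
      have hsub : (Finset.univ.filter fun i => (cols i : ℕ) < a) ⊆
          Finset.Iio (Fin.castLE hle i) := by
        intro x hx
        simp only [Finset.mem_filter, Finset.mem_univ, true_and, Finset.mem_Iio] at hx ⊢
        by_contra hxi
        have := cols.monotone (not_lt.1 hxi)
        rw [Fin.le_def] at this
        omega
      have := Finset.card_le_card hsub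
      rw [Fin.card_Iio, Fin.val_castLE] at this
      have := i.2
      omega
    refine det_submatrix_mem_of_forall_mem _ _ hle cols (fun rows' => ?_) rows
    exact Ideal.subset_span ⟨rows', OrderEmbedding.ofStrictMono (fun i => ⟨_, hlt i⟩)
      (fun i j hij => cols.strictMono (Fin.strictMono_castLE hle hij)), rfl⟩
  · rcases hrt with hrt | hrt
    · rintro f ⟨hft, hfr⟩
      refine mem_of_mem_minorIdeal_inf k ha r hrt _ (fun rows cols h => ?_) hft hfr
      refine Ideal.subset_span ⟨⟨rows, cols, rfl⟩, ?_⟩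
      rwa [exists_isWeightedHomogeneous_det_le_iff k a hpq, ← hr]
    -- Here `r` is positive and `A` has no `r`-minors, so the right-hand ideal is zero.
    · refine inf_le_right.trans ?_
      rw [minorIdeal, Ideal.span_le]
      rintro _ ⟨rows, cols, -⟩
      have h1 := Fintype.card_le_of_injective _ rows.injective
      have h2 := Fintype.card_le_of_injective _ cols.injective
      simp only [Fintype.card_fin] at h1 h2
      omega
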